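/- Let $S$ and $A$ be finite sets, and let $\{q_\theta:\theta\in\Theta\}$ be a canonical one-parameter exponential family on $\mathbb R$: $q_\theta(dx)=e^{\theta x-b(\theta)}\nu(dx)$, where $\nu$ is not carried by a single point, $\Theta$ is an open interval, and $b(\theta)=\log\int e^{\theta x}\nu(dx)<\infty$ on $\Theta$. Each $q_\theta$ is thus determined by its mean. A deterministic MDP (DMDP) $\phi$ consists of a transition map $S\times A\to S$ and a choice, for each pair $(s,a)$, of a reward law in the family; its mean is denoted $r_\phi(s,a)$. The transition map gives the next state, and the reward in $(s,a)$ is drawn independently from the law of that pair. A policy chooses each action at random, depending on the past states, actions and rewards and on the current state. For a policy $\pi$ and an initial state $s_1$, let $N_T(s,a)$ be the number of visits of $(s,a)$ in the first $T$ rounds, $V^\pi_T(s_1)=\mathbb E^\pi_{\phi|s_1}\big[\sum_{t=1}^T r_\phi(s_t,a_t)\big]$, and $R^\pi_T(\phi,s_1)=\sup_{\pi'}V^{\pi'}_T(s_1)-V^\pi_T(s_1)$, the supremum being over all policies. A simple cycle is a closed walk of state-action pairs without repeated states. Let $C^\star_\phi$ be the set of pairs lying on a simple cycle whose average mean reward is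 maximal among all simple cycles (the pairs of the optimal cycle, if it is unique). A policy $\pi$ is uniformly good on a class $\Phi$ of DMDPs on $S,A$ if $\mathbb E^\pi_{\phi|s_1}[N_T(s,a)]=o(T^\alpha)$ as $T\to\infty$ for all $\phi\in\Phi$, $s_1\in S$, $\alpha>0$ and $(s,a)\notin C^\star_\phi$. Let $\phi$ be a DMDP that is communicating (every state can be reached from every state under some stationary deterministic policy), in which it is always possible to stay in place (every state $s$ has an action leading from $s$ to $s$), and whose rewards are state-dependent: the reward law of a pair $(s,a)$ depends only on the state $s'$ it leads to, and is then denoted $q_\phi(s')$, with mean $r_\phi(s')$. Let $s^\star$ be a state with $r^\star:=r_\phi(s^\star)=\max_s r_\phi(s)$. Let $\Phi$ be any class of DMDPs on $S,A$ that contains all DMDPs with state-dependent rewards and the same transition map as $\phi$ (for instance, the class of all communicating DMDPs on $S,A$), and let $\pi$ be uniformly good on $\Phi$. Then for every initial state $s_1$, $$\liminf_{T\to\infty}\frac{R_T^\pi(\phi,s_1)}{\log T}\;\ge\;\sum_{s\ne s^\star}\frac{r^\star-r_\phi(s)}{\mathrm{KL}(r_\phi(s),r^\star)},$$ where $\mathrm{KL}(r,r')$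 is the Kullback-Leibler divergence between the members of the family with means $r$ and $r'$, and a term with $r_\phi(s)=r^\star$ is read as $0$. The right-hand side has the form of the Lai-Robbins lower bound for the multi-armed bandit. -/

import Mathlib

open MeasureTheory ProbabilityTheory Filter Asymptotics
open scoped ENNReal Topology

noncomputable section

namespace DetMDP

/-- A (regular, canonical) one-parameter exponential family of reward distributions on the line:
the laws with density `x ↦ exp (θ x - b θ)` with respect to a fixed dominating measure, where
`b θ = log ∫ exp (θ x)` and `θ` ranges over an open interval `Θ` on which `b` is finite.
The dominating measure is not carried by a single point, which makes the mean `b' θ` strictly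
increasing in `θ`, so that a member of the family is determined by its mean. -/
structure ExpFamily where
  /-- the dominating measure -/
  base : Measure ℝ
  /-- the interval of natural parameters -/
  Θ : Set ℝ
  isOpen_Θ : IsOpen Θ
  ordConnected_Θ : Θ.OrdConnected
  integrable_exp : ∀ θ ∈ Θ, Integrable (fun x : ℝ => Real.exp (θ * x)) base
  nondegenerate : ∀ c : ℝ, base {c}ᶜ ≠ 0

namespace ExpFamily

variable (F : ExpFamily)

/-- The member of the family with natural parameter `θ`, of density
`exp (θ x) / ∫ exp (θ y) d(base)(y)` with respect to the dominating measure. -/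
def law (θ : F.Θ) : Measure ℝ := F.base.tilted (fun x => (θ : ℝ) * x)

instance (θ : F.Θ) : IsProbabilityMeasure (F.law θ) := by
  have : NeZero F.base := ⟨fun h => F.nondegenerate 0 (by simp [h])⟩
  exact isProbabilityMeasure_tilted (F.integrable_exp θ θ.2)

/-- The mean of the member with natural parameter `θ`. -/
def mean (θ : F.Θ) : ℝ := ∫ x, x ∂(F.law θ)

/-- Kullback-Leibler divergence between two members of the family. -/
def kl (θ θ' : F.Θ) : ℝ := (InformationTheory.klDiv (F.law θ) (F.law θ')).toReal

end ExpFamily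

/-- A deterministic Markov decision process with state space `S`, action space `A` and rewards in
the exponential family `F`: taking action `a` in state `s` leads to the state `next s a` and gives
an independent random reward with law `F.law (param s a)`. -/
structure DMDP (S A : Type*) (F : ExpFamily) where
  next : S → A → S
  param : S → A → F.Θ

/-- A history-dependent randomized policy. `init` gives the law of the first action from the
initial state. `step n` gives the law of the action number `n + 2` from the states, actions and
rewards of the first `n + 1` rounds (indexed by `0, …, n`) and the current state. -/
structure Policy (S A : Type*) [MeasurableSpace S] [MeasurableSpace A] where
  init : Kernel S A
  step : (n : ℕ) → Kernel ((Finset.Iic n → S × A × ℝ) × S) A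
  isMarkov_init : IsMarkovKernel init
  isMarkov_step : ∀ n, IsMarkovKernel (step n)

attribute [instance] Policy.isMarkov_init Policy.isMarkov_step

namespace DMDP

section Graph

variable {S A : Type*} {F : ExpFamily} (φ : DMDP S A F)

/-- The mean reward of a state-action pair. -/
def r (s : S) (a : A) : ℝ := F.mean (φ.param s a)

/-- Any state is accessible from any state under some stationary deterministic policy. -/
def Communicating : Prop :=
  ∀ s s' : S, ∃ μ : S → A, ∃ n : ℕ, (fun x => φ.next x (μ x))^[n] s = s'

/-- A simple cycle of length `k + 1`: a closed walk of state-action pairs whose states are distinct.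
Addition in `Fin (k + 1)` is cyclic, so the last pair leads to the state of the first one. -/
def IsSimpleCycle {k : ℕ} (c : Fin (k + 1) → S × A) : Prop :=
  (∀ i, φ.next (c i).1 (c i).2 = (c (i + 1)).1) ∧ Function.Injective (fun i => (c i).1)

/-- The gain of a cycle: its average mean reward. -/
def gain {k : ℕ} (c : Fin (k + 1) → S × A) : ℝ :=
  (∑ i, φ.r (c i).1 (c i).2) / (k + 1 : ℕ)

/-- A simple cycle of maximal gain. -/
def IsOptimalCycle {k : ℕ} (c : Fin (k + 1) → S × A) : Prop :=
  φ.IsSimpleCycle c ∧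
    ∀ (l : ℕ) (d : Fin (l + 1) → S × A), φ.IsSimpleCycle d → φ.gain d ≤ φ.gain c

/-- The state-action pairs that lie on an optimal cycle. When there is only one optimal cycle,
these are its pairs. -/
def optimalPairs : Set (S × A) :=
  {p | ∃ (k : ℕ) (c : Fin (k + 1) → S × A), φ.IsOptimalCycle c ∧ p ∈ Set.range c}

/-- The process with transition function `next` and state-dependent rewards: all state-action pairs
that lead to the same state `s'` have the same reward law `F.law (θ s')`. -/
def stateDependent (next : S → A → S) (θ : S → F.Θ) : DMDP S A F where
  next := next
  param := fun s a => θ (next s a)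

end Graph

section Law

variable {S A : Type*} [Fintype S] [Fintype A] [MeasurableSpace S] [MeasurableSpace A]
  [DiscreteMeasurableSpace S] [DiscreteMeasurableSpace A] {F : ExpFamily} (φ : DMDP S A F)

/-- The reward law as a kernel. -/
def rewardKernel : Kernel (S × A) ℝ where
  toFun := fun p => F.law (φ.param p.1 p.2)
  measurable' := .of_discrete

instance : IsMarkovKernel φ.rewardKernel :=
  ⟨fun p => inferInstanceAs (IsProbabilityMeasure (F.law (φ.param p.1 p.2)))⟩

/-- One round: from the data `y`, the current state is `st y`, the action has law `κ y`, and the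
reward is drawn from the reward law at the current state and action. -/
def round {Y : Type*} [MeasurableSpace Y] (st : Y → S) (hst : Measurable st) (κ : Kernel Y A) :
    Kernel Y (S × A × ℝ) :=
  Kernel.deterministic st hst ×ₖ
    (κ ⊗ₖ φ.rewardKernel.comap (fun p : Y × A => (st p.1, p.2)) (by fun_prop))

instance {Y : Type*} [MeasurableSpace Y] (st : Y → S) (hst : Measurable st) (κ : Kernel Y A)
    [IsMarkovKernel κ] : IsMarkovKernel (φ.round st hst κ) := by
  unfold round; infer_instance

/-- The state reached after the history `h` of the rounds `0, …, n`. -/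
def current {n : ℕ} (h : Finset.Iic n → S × A × ℝ) : S :=
  φ.next (h ⟨n, Finset.mem_Iic.2 le_rfl⟩).1 (h ⟨n, Finset.mem_Iic.2 le_rfl⟩).2.1

lemma measurable_current {n : ℕ} :
    Measurable (φ.current : (Finset.Iic n → S × A × ℝ) → S) := by
  have h1 : Measurable (fun p : S × A => φ.next p.1 p.2) := .of_discrete
  have h2 : Measurable (fun h : Finset.Iic n → S × A × ℝ =>
      ((h ⟨n, Finset.mem_Iic.2 le_rfl⟩).1, (h ⟨n, Finset.mem_Iic.2 le_rfl⟩).2.1)) := by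
    fun_prop
  exact h1.comp h2

/-- The transition kernel of the process of (state, action, reward) triples under a policy. -/
def stepKernel (π : Policy S A) (n : ℕ) : Kernel (Finset.Iic n → S × A × ℝ) (S × A × ℝ) :=
  φ.round φ.current φ.measurable_current
    ((π.step n).comap (fun h => (h, φ.current h)) (measurable_id.prodMk φ.measurable_current))

instance (π : Policy S A) (n : ℕ) : IsMarkovKernel (φ.stepKernel π n) := by
  unfold stepKernel; infer_instance

/-- The law of the infinite sequence of (state, action, reward) triples when the policy `π` is
followed from the initial state `s₁`. -/
def trajLaw (π : Policy S A) (s₁ : S) : Measure (ℕ → S × A × ℝ) :=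
  Kernel.trajMeasure (X := fun _ => S × A × ℝ)
    (φ.round id measurable_id π.init s₁) (φ.stepKernel π)

instance (π : Policy S A) (s₁ : S) : IsProbabilityMeasure (φ.trajLaw π s₁) := by
  unfold trajLaw; infer_instance

open Classical in
/-- The number of visits `N_T(s,a)` of a pair in the first `T` rounds. -/
def visits (s : S) (a : A) (T : ℕ) (ω : ℕ → S × A × ℝ) : ℕ :=
  ((Finset.range T).filter (fun t => (ω t).1 = s ∧ (ω t).2.1 = a)).card

/-- The expected number of visits of a pair in the first `T` rounds. -/
def expVisits (π : Policy S A) (s₁ : S) (s : S) (a : A) (T : ℕ) : ℝ :=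
  ∫ ω, (visits s a T ω : ℝ) ∂(φ.trajLaw π s₁)

/-- The expected cumulative reward in the first `T` rounds. -/
def value (π : Policy S A) (s₁ : S) (T : ℕ) : ℝ :=
  ∫ ω, ∑ t ∈ Finset.range T, φ.r (ω t).1 (ω t).2.1 ∂(φ.trajLaw π s₁)

/-- The optimal expected cumulative reward, over all policies. -/
def optValue (s₁ : S) (T : ℕ) : ℝ := ⨆ π : Policy S A, φ.value π s₁ T

/-- The regret up to time `T`. -/
def regret (π : Policy S A) (s₁ : S) (T : ℕ) : ℝ := φ.optValue s₁ T - φ.value π s₁ T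

end Law

end DMDP

/-- A policy is uniformly good on a class `Φ` of deterministic MDPs if for every process in `Φ`,
every initial state and every `α > 0`, each pair off the optimal cycles is visited `o(T ^ α)` times
in expectation. -/
def UniformlyGood {S A : Type*} [Fintype S] [Fintype A] [MeasurableSpace S] [MeasurableSpace A]
    [DiscreteMeasurableSpace S] [DiscreteMeasurableSpace A] {F : ExpFamily}
    (Φ : Set (DMDP S A F)) (π : Policy S A) : Prop :=
  ∀ φ ∈ Φ, ∀ s₁ : S, ∀ α : ℝ, 0 < α → ∀ s : S, ∀ a : A, (s, a) ∉ φ.optimalPairs →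
    (fun T : ℕ => φ.expVisits π s₁ s a T) =o[atTop] (fun T : ℕ => (T : ℝ) ^ α)

end DetMDP

end

/-! The states play the role of bandit arms: a round that leads into `s` reveals information about
`q(s)` only and costs exactly the gap `r⋆ - r(s)`, wherever it starts. It therefore suffices to
bound the expected number of entries into each suboptimal `s` from below by about `log T / KL`, and
to write the regret as gaps times entries.

For the entries, raise the parameter of `s` alone to some `lam` slightly above that of `sStar`
(`ExpFamily.exists_gt_kl_lt`). The self-loops of `s` then become the only optimal pairs
(`eq_of_mem_optimalPairs`), so a uniformly good policy spends all but `o(T ^ α)` expected rounds on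
them, whereas under the true process it spends only `o(T)` there (`loop_notMem_optimalPairs`).
Telling the two processes apart requires information: by change of measure and `x + 1 ≤ exp x`,
`integral_sub_integral_exp_le` bounds any difference in behaviour by the expected log-likelihood
ratio, which here is `kl` times the number of entries into `s`. Testing with `c` times the fraction
of rounds spent off the self-loops, with `c` close to `log T`, gives `eventually_le_expEntries`.

For the regret, walking to `sStar` and staying there loses only a constant against `T * r⋆`
(`exists_le_optValue`), which leads to `exists_le_regret`. -/

noncomputable section

namespace DetMDP

/-! ### Kullback-Leibler divergence in an exponential family -/

namespace ExpFamily

variable (F : ExpFamily)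

lemma mem_interior_integrableExpSet (θ : F.Θ) :
    (θ : ℝ) ∈ interior (integrableExpSet id F.base) := by
  have hsub : F.Θ ⊆ integrableExpSet id F.base := fun t ht => F.integrable_exp t ht
  exact interior_mono hsub (F.isOpen_Θ.interior_eq.symm ▸ θ.2)

lemma mgf_pos (θ : F.Θ) : 0 < mgf id F.base θ := by
  have : NeZero F.base := ⟨fun h => F.nondegenerate 0 (by simp [h])⟩
  exact integral_exp_pos (F.integrable_exp θ θ.2)

/-- The log-likelihood ratio of two members of the family. -/
def logRatio (θ θ' : F.Θ) (x : ℝ) : ℝ :=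
  Real.log (mgf id F.base θ') - Real.log (mgf id F.base θ) - (θ' - θ) * x

lemma integrable_id_law (θ : F.Θ) : Integrable (fun x : ℝ => x) (F.law θ) := by
  have h := (memLp_tilted_mul (F.mem_interior_integrableExpSet θ) 1).integrable (by simp)
  exact h

lemma integrable_logRatio (θ θ' : F.Θ) : Integrable (F.logRatio θ θ') (F.law θ) := by
  unfold logRatio
  exact (integrable_const _).sub ((F.integrable_id_law θ).const_mul _)

lemma integrable_exp_law (θ θ' : F.Θ) :
    Integrable (fun x : ℝ => Real.exp ((θ' - θ) * x)) (F.law θ) := by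
  rw [law, integrable_tilted_iff (F.integrable_exp θ θ.2)]
  refine (F.integrable_exp θ' θ'.2).congr (ae_of_all _ fun x => ?_)
  simp only [smul_eq_mul]
  rw [← Real.exp_add]
  ring_nf

/-- Tilts compose, so any member can serve as the dominating measure for the others. -/
lemma law_eq_tilted (θ θ' : F.Θ) :
    F.law θ' = (F.law θ).tilted (fun x => (θ' - θ) * x) := by
  rw [law, law, tilted_tilted (F.integrable_exp θ θ.2)]
  congr 1
  ext x
  simp only [Pi.add_apply]
  ring

lemma log_integral_exp_law (θ θ' : F.Θ) :
    Real.log (∫ x, Real.exp ((θ' - θ) * x) ∂(F.law θ)) =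
      Real.log (mgf id F.base θ') - Real.log (mgf id F.base θ) := by
  rw [law, integral_exp_tilted, ← Real.log_div (F.mgf_pos θ').ne' (F.mgf_pos θ).ne']
  have : ∀ x : ℝ, ((fun x : ℝ => (θ : ℝ) * x) + fun x : ℝ => ((θ' : ℝ) - θ) * x) x = θ' * x := by
    intro x; simp only [Pi.add_apply]; ring
  simp only [this]
  rfl

lemma lintegral_law (θ θ' : F.Θ) (f : ℝ → ℝ≥0∞) :
    ∫⁻ x, f x ∂(F.law θ') =
      ∫⁻ x, ENNReal.ofReal (Real.exp (-F.logRatio θ θ' x)) * f x ∂(F.law θ) := by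
  rw [F.law_eq_tilted θ θ', lintegral_tilted]
  refine lintegral_congr fun x => ?_
  congr 2
  rw [logRatio, ← F.log_integral_exp_law, neg_sub, Real.exp_sub, Real.exp_log]
  exact integral_exp_pos (F.integrable_exp_law θ θ')

/-- Both laws have mass one, so the mass correction in `klDiv` drops out and only the mean of the
log-likelihood ratio remains. -/
lemma kl_eq_integral (θ θ' : F.Θ) : F.kl θ θ' = ∫ x, F.logRatio θ θ' x ∂(F.law θ) := by
  have hac : F.law θ ≪ F.law θ' := by
    rw [F.law_eq_tilted θ θ']
    exact absolutelyContinuous_tilted (F.integrable_exp_law θ θ')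
  rw [kl, InformationTheory.toReal_klDiv_of_measure_eq hac (by simp)]
  refine integral_congr_ae ?_
  have h := llr_tilted_right (Measure.AbsolutelyContinuous.refl (F.law θ))
    (F.integrable_exp_law θ θ')
  rw [← F.law_eq_tilted θ θ'] at h
  filter_upwards [h, llr_self (F.law θ)] with x hx hx'
  rw [hx, hx', F.log_integral_exp_law, logRatio]
  simp only [Pi.zero_apply]
  ring

lemma kl_eq (θ θ' : F.Θ) : F.kl θ θ' =
    Real.log (mgf id F.base θ') - Real.log (mgf id F.base θ) - (θ' - θ) * F.mean θ := by
  rw [kl_eq_integral]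
  unfold logRatio
  rw [integral_sub (integrable_const _) ((F.integrable_id_law θ).const_mul _), integral_const_mul]
  simp [mean]

lemma kl_self (θ : F.Θ) : F.kl θ θ = 0 := by simp [kl_eq]

lemma kl_nonneg (θ θ' : F.Θ) : 0 ≤ F.kl θ θ' := ENNReal.toReal_nonneg

/-- If two parameters gave the same law, the affine function `logRatio`, of nonzero slope, would
vanish almost everywhere; the base measure would then sit on its single zero `c`, against
`nondegenerate`. -/
lemma law_injective : Function.Injective F.law := by
  intro θ θ' h
  by_contra hne
  have hne' : (θ' : ℝ) - θ ≠ 0 := sub_ne_zero.2 fun h => hne (Subtype.ext h.symm)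
  have h1 := log_rnDeriv_tilted_left_self (F.integrable_exp_law θ θ')
  rw [← F.law_eq_tilted θ θ', ← h] at h1
  set c := Real.log (∫ x, Real.exp ((θ' - θ) * x) ∂(F.law θ)) / (θ' - θ) with hc
  have h2 : ∀ᵐ x ∂(F.law θ), x = c := by
    filter_upwards [h1, Measure.rnDeriv_self (F.law θ)] with x hx hx'
    rw [hx'] at hx
    simp only [ENNReal.toReal_one, Real.log_one] at hx
    rw [hc, eq_div_iff hne']
    linarith
  have h3 : ∀ᵐ x ∂F.base, x = c :=
    (absolutelyContinuous_tilted (F.integrable_exp θ θ.2)).ae_le h2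
  exact F.nondegenerate c h3

/-- Since `kl` is a `toReal`, the divergence must be shown finite as well as nonzero; finiteness
comes from integrability of the log-likelihood ratio. -/
lemma kl_pos {θ θ' : F.Θ} (h : θ ≠ θ') : 0 < F.kl θ θ' := by
  have hac : F.law θ ≪ F.law θ' := by
    rw [F.law_eq_tilted θ θ']
    exact absolutelyContinuous_tilted (F.integrable_exp_law θ θ')
  have hint : Integrable (llr (F.law θ) (F.law θ')) (F.law θ) := by
    rw [F.law_eq_tilted θ θ']
    refine integrable_llr_tilted_right (Measure.AbsolutelyContinuous.refl _)
      ((F.integrable_id_law θ).const_mul _) ?_ (F.integrable_exp_law θ θ')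
    exact (integrable_zero _ _ _).congr (llr_self _).symm
  refine ENNReal.toReal_pos (fun h0 => h (F.law_injective ?_))
    (InformationTheory.klDiv_ne_top hac hint)
  exact InformationTheory.klDiv_eq_zero_iff.1 h0

/-- The symmetrized divergence equals `(θ' - θ) * (mean θ' - mean θ)` and is positive. -/
lemma mean_strictMono : StrictMono F.mean := by
  intro θ θ' h
  have h1 := F.kl_pos h.ne
  have h2 := F.kl_nonneg θ' θ
  have h3 : (0 : ℝ) < θ' - θ := sub_pos.2 h
  have h4 : F.kl θ θ' + F.kl θ' θ = (θ' - θ) * (F.mean θ' - F.mean θ) := by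
    rw [kl_eq, kl_eq]; ring
  have h5 : 0 < (θ' - θ : ℝ) * (F.mean θ' - F.mean θ) := by linarith
  exact sub_pos.1 ((mul_pos_iff_of_pos_left h3).1 h5)

/-- The closed form `kl_eq` is continuous in its second parameter, and `Θ` is open, so there is room
to the right of `θ'`. This supplies alternatives strictly better than the optimal state at almost
the same information cost. -/
lemma exists_gt_kl_lt (θ θ' : F.Θ) {K : ℝ} (hK : F.kl θ θ' < K) :
    ∃ θ'' : F.Θ, θ' < θ'' ∧ F.kl θ θ'' < K := by
  have hcont : ContinuousAt (fun t : ℝ => Real.log (mgf id F.base t) -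
      Real.log (mgf id F.base θ) - (t - θ) * F.mean θ) θ' := by
    have h1 : ContinuousAt (mgf id F.base) (θ' : ℝ) :=
      (differentiableAt_mgf (F.mem_interior_integrableExpSet θ')).continuousAt
    have h2 := h1.log (F.mgf_pos θ').ne'
    fun_prop
  rw [kl_eq] at hK
  have h3 : ∀ᶠ t in 𝓝 (θ' : ℝ), Real.log (mgf id F.base t) -
      Real.log (mgf id F.base θ) - (t - θ) * F.mean θ < K := hcont.eventually_lt_const hK
  have h4 : ∀ᶠ t in 𝓝[>] (θ' : ℝ), t ∈ F.Θ ∧ Real.log (mgf id F.base t) -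
      Real.log (mgf id F.base θ) - (t - θ) * F.mean θ < K :=
    nhdsWithin_le_nhds (Eventually.and (F.isOpen_Θ.mem_nhds θ'.2) h3)
  obtain ⟨t, ⟨ht, htK⟩, hlt⟩ := (h4.and self_mem_nhdsWithin).exists
  exact ⟨⟨t, ht⟩, hlt, by rwa [kl_eq]⟩

end ExpFamily

/-! ### Integration against trajectory laws and change of measure -/

section Trajectory

variable {X : Type*} [MeasurableSpace X] {μ₀ : Measure X} [IsProbabilityMeasure μ₀]
  {κ : (n : ℕ) → Kernel (Finset.Iic n → X) X} [∀ n, IsMarkovKernel (κ n)]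

omit [IsProbabilityMeasure μ₀] in
lemma lintegral_trajMeasure_zero {f : (Finset.Iic 0 → X) → ℝ≥0∞} (hf : Measurable f) :
    ∫⁻ ω, f (Preorder.frestrictLe 0 ω) ∂(Kernel.trajMeasure (X := fun _ => X) μ₀ κ) =
      ∫⁻ x, f (fun _ => x) ∂μ₀ := by
  have hm : (Kernel.trajMeasure (X := fun _ => X) μ₀ κ).map (Preorder.frestrictLe 0) =
      μ₀.map (fun x _ => x) := by
    rw [Kernel.trajMeasure, Measure.map_comp _ _ (by fun_prop), Kernel.traj_map_frestrictLe,
      Kernel.partialTraj_self, Measure.id_comp]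
    rfl
  rw [← lintegral_map (μ := Kernel.trajMeasure (X := fun _ => X) μ₀ κ) hf
    (Preorder.measurable_frestrictLe 0), hm, lintegral_map hf (by fun_prop)]

lemma lintegral_trajMeasure_succ (n : ℕ) {f : (Finset.Iic n → X) × X → ℝ≥0∞}
    (hf : Measurable f) :
    ∫⁻ ω, f (Preorder.frestrictLe n ω, ω (n + 1)) ∂(Kernel.trajMeasure (X := fun _ => X) μ₀ κ) =
      ∫⁻ ω, ∫⁻ x, f (Preorder.frestrictLe n ω, x) ∂(κ n (Preorder.frestrictLe n ω))
        ∂(Kernel.trajMeasure (X := fun _ => X) μ₀ κ) := by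
  have h := Kernel.map_frestrictLe_trajMeasure_compProd_eq_map_trajMeasure
    (X := fun _ => X) (μ₀ := μ₀) (κ := κ) (a := n)
  have h1 := congrArg (fun m => ∫⁻ p, f p ∂m) h
  rw [lintegral_map hf (by fun_prop), Measure.lintegral_compProd hf, lintegral_map
    hf.lintegral_kernel_prod_right' (by fun_prop)] at h1
  exact h1.symm

/-- A measurable function of the first `n + 2` coordinates, as a function of the first `n + 1`
coordinates and the next one. -/
lemma exists_measurable_frestrictLe_succ (n : ℕ) {f : (Finset.Iic (n + 1) → X) → ℝ≥0∞}
    (hf : Measurable f) : ∃ g : (Finset.Iic n → X) × X → ℝ≥0∞, Measurable g ∧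
      ∀ ω : ℕ → X, f (Preorder.frestrictLe (π := fun _ => X) (n + 1) ω) =
        g (Preorder.frestrictLe (π := fun _ => X) n ω, ω (n + 1)) := by
  classical
  refine ⟨fun p => f (fun i => if h : (i : ℕ) ≤ n then p.1 ⟨i, Finset.mem_Iic.2 h⟩ else p.2),
    hf.comp (measurable_pi_lambda _ fun i => ?_), fun ω => ?_⟩
  · by_cases h : (i : ℕ) ≤ n
    · simp only [h, dite_true]; fun_prop
    · simp only [h, dite_false]; fun_prop
  · congr 1
    ext i
    by_cases h : (i : ℕ) ≤ n
    · simp [h]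
    · have hi := Finset.mem_Iic.1 i.2
      have : (i : ℕ) = n + 1 := by omega
      simp [this]

/-- The same density `w`, a function of the newest coordinate alone, relates the initial laws and
all transition kernels, so the likelihood ratio of a finite history is a product. The induction
integrates out the last coordinate. -/
lemma lintegral_trajMeasure_change {μ₀' : Measure X} [IsProbabilityMeasure μ₀']
    {κ' : (n : ℕ) → Kernel (Finset.Iic n → X) X} [∀ n, IsMarkovKernel (κ' n)]
    {w : X → ℝ≥0∞} (hw : Measurable w)
    (h0 : ∀ f : X → ℝ≥0∞, Measurable f → ∫⁻ x, f x ∂μ₀' = ∫⁻ x, w x * f x ∂μ₀)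
    (hκ : ∀ n h, ∀ f : X → ℝ≥0∞, Measurable f →
      ∫⁻ x, f x ∂(κ' n h) = ∫⁻ x, w x * f x ∂(κ n h))
    (n : ℕ) {f : (Finset.Iic n → X) → ℝ≥0∞} (hf : Measurable f) :
    ∫⁻ ω, f (Preorder.frestrictLe n ω) ∂(Kernel.trajMeasure (X := fun _ => X) μ₀' κ') =
      ∫⁻ ω, (∏ t ∈ Finset.range (n + 1), w (ω t)) * f (Preorder.frestrictLe n ω)
        ∂(Kernel.trajMeasure (X := fun _ => X) μ₀ κ) := by
  induction n with
  | zero =>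
    rw [lintegral_trajMeasure_zero hf, h0 _ (by fun_prop)]
    have := lintegral_trajMeasure_zero (μ₀ := μ₀) (κ := κ)
      (f := fun h => w (h ⟨0, Finset.mem_Iic.2 le_rfl⟩) * f h) (by fun_prop)
    simp only [zero_add, Finset.prod_range_one]
    exact this.symm
  | succ n ih =>
    obtain ⟨g, hg, hfg⟩ := exists_measurable_frestrictLe_succ n hf
    simp only [hfg]
    rw [lintegral_trajMeasure_succ n hg]
    have hstep : ∀ ω : ℕ → X,
        ∫⁻ x, g (Preorder.frestrictLe n ω, x) ∂(κ' n (Preorder.frestrictLe n ω)) =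
        ∫⁻ x, w x * g (Preorder.frestrictLe n ω, x) ∂(κ n (Preorder.frestrictLe n ω)) :=
      fun ω => hκ _ _ _ (by fun_prop)
    simp only [hstep]
    have hG : Measurable fun p : (Finset.Iic n → X) × X => w p.2 * g p := by fun_prop
    rw [ih (f := fun h => ∫⁻ x, w x * g (h, x) ∂(κ n h)) hG.lintegral_kernel_prod_right']
    -- The product over the past is put into the test function, so that the one-step formula under
    -- `κ` reassembles the full weight.
    have hF : Measurable fun p : (Finset.Iic n → X) × X =>
        (∏ t : Finset.Iic n, w (p.1 t)) * (w p.2 * g p) := by fun_prop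
    have hprod : ∀ ω : ℕ → X, ∏ t ∈ Finset.range (n + 1), w (ω t) =
        ∏ t : Finset.Iic n, w (Preorder.frestrictLe (π := fun _ => X) n ω t) := by
      intro ω
      have : Finset.range (n + 1) = Finset.Iic n := by ext; simp
      rw [this]
      exact (Finset.prod_coe_sort (Finset.Iic n) (fun t => w (ω t))).symm
    have := lintegral_trajMeasure_succ (μ₀ := μ₀) (κ := κ) n hF
    simp only [Finset.prod_range_succ _ (n + 1), hprod, mul_assoc]
    rw [this]
    refine lintegral_congr fun ω => ?_
    exact (lintegral_const_mul _ (by fun_prop)).symm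

end Trajectory

/-! ### One round of the process -/

namespace DMDP

variable {S A : Type*} [Fintype S] [Fintype A] [MeasurableSpace S] [MeasurableSpace A]
  [DiscreteMeasurableSpace S] [DiscreteMeasurableSpace A] {F : ExpFamily} (φ : DMDP S A F)

lemma lintegral_round {Y : Type*} [MeasurableSpace Y] (st : Y → S) (hst : Measurable st)
    (κ : Kernel Y A) [IsMarkovKernel κ] (y : Y) {f : S × A × ℝ → ℝ≥0∞} (hf : Measurable f) :
    ∫⁻ x, f x ∂(φ.round st hst κ y) =
      ∫⁻ a, ∫⁻ r, f (st y, a, r) ∂(F.law (φ.param (st y) a)) ∂(κ y) := by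
  rw [round, Kernel.lintegral_deterministic_prod hst _ _ hf,
    Kernel.lintegral_compProd _ _ _ (by fun_prop)]
  rfl

/-- Redrawing the reward given the pair does not change the law of a round. This is the source of
the disintegration `map_trajLaw_eval`. -/
lemma lintegral_round_eq {Y : Type*} [MeasurableSpace Y] (st : Y → S) (hst : Measurable st)
    (κ : Kernel Y A) [IsMarkovKernel κ] (y : Y) {f : S × A × ℝ → ℝ≥0∞} (hf : Measurable f) :
    ∫⁻ x, f x ∂(φ.round st hst κ y) =
      ∫⁻ x, ∫⁻ r, f (x.1, x.2.1, r) ∂(F.law (φ.param x.1 x.2.1)) ∂(φ.round st hst κ y) := by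
  set J : S × A → ℝ≥0∞ := fun p => ∫⁻ r, f (p.1, p.2, r) ∂(F.law (φ.param p.1 p.2)) with hJ
  have h1 : Measurable J := .of_discrete
  have h2 : Measurable fun x : S × A × ℝ => (x.1, x.2.1) := by fun_prop
  have h3 := lintegral_round φ st hst κ y (f := fun x => J (x.1, x.2.1)) (h1.comp h2)
  rw [lintegral_round φ st hst κ y hf]
  simp only [lintegral_const, measure_univ, mul_one] at h3
  exact h3.symm

end DMDP

/-! ### Likelihood ratios, visit counts and the information inequality -/

namespace DMDP

variable {S A : Type*} [Fintype S] [Fintype A] [MeasurableSpace S] [MeasurableSpace A]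
  [DiscreteMeasurableSpace S] [DiscreteMeasurableSpace A] {F : ExpFamily} (φ : DMDP S A F)
  (π : Policy S A) (s₁ : S)

lemma measurable_of_pair {Y Z : Type*} [MeasurableSpace Y] [MeasurableSpace Z] (h : S → A → Z)
    {f : Y → S} {g : Y → A} (hf : Measurable f) (hg : Measurable g) :
    Measurable fun y => h (f y) (g y) := by
  have h1 : Measurable fun p : S × A => h p.1 p.2 := .of_discrete
  exact h1.comp (hf.prodMk hg)

lemma measurable_logRatio_pair (param param' : S → A → F.Θ) :
    Measurable fun x : S × A × ℝ =>
      F.logRatio (param x.1 x.2.1) (param' x.1 x.2.1) x.2.2 := by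
  have h1 := measurable_of_pair (fun s a => Real.log (mgf id F.base (param' s a)) -
    Real.log (mgf id F.base (param s a))) (Y := S × A × ℝ) measurable_fst
    (measurable_fst.comp measurable_snd)
  have h2 := measurable_of_pair (fun s a => (param' s a - param s a : ℝ)) (Y := S × A × ℝ)
    measurable_fst (measurable_fst.comp measurable_snd)
  exact h1.sub (h2.mul (by fun_prop))

/-- State and action are generated identically in both processes, so only the reward density enters.
-/
lemma lintegral_round_change (param' : S → A → F.Θ) {Y : Type*} [MeasurableSpace Y] (st : Y → S)
    (hst : Measurable st) (κ : Kernel Y A) [IsMarkovKernel κ] (y : Y) {f : S × A × ℝ → ℝ≥0∞}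
    (hf : Measurable f) :
    ∫⁻ x, f x ∂((⟨φ.next, param'⟩ : DMDP S A F).round st hst κ y) =
      ∫⁻ x, ENNReal.ofReal (Real.exp (-F.logRatio (φ.param x.1 x.2.1) (param' x.1 x.2.1) x.2.2)) *
        f x ∂(φ.round st hst κ y) := by
  have := measurable_logRatio_pair φ.param param'
  rw [lintegral_round _ st hst κ y hf, lintegral_round φ st hst κ y (by fun_prop)]
  exact lintegral_congr fun a => F.lintegral_law _ _ _

/-- Change of measure between two processes with the same transitions. -/
lemma lintegral_trajLaw_change (param' : S → A → F.Θ) (n : ℕ)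
    {f : (Finset.Iic n → S × A × ℝ) → ℝ≥0∞} (hf : Measurable f) :
    ∫⁻ ω, f (Preorder.frestrictLe n ω) ∂((⟨φ.next, param'⟩ : DMDP S A F).trajLaw π s₁) =
      ∫⁻ ω, ENNReal.ofReal (Real.exp (-∑ t ∈ Finset.range (n + 1),
          F.logRatio (φ.param (ω t).1 (ω t).2.1) (param' (ω t).1 (ω t).2.1) (ω t).2.2)) *
        f (Preorder.frestrictLe n ω) ∂(φ.trajLaw π s₁) := by
  have hwm := measurable_logRatio_pair φ.param param'
  have := lintegral_trajMeasure_change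
    (μ₀ := φ.round id measurable_id π.init s₁) (κ := φ.stepKernel π)
    (μ₀' := (⟨φ.next, param'⟩ : DMDP S A F).round id measurable_id π.init s₁)
    (κ' := (⟨φ.next, param'⟩ : DMDP S A F).stepKernel π) hwm.neg.exp.ennreal_ofReal
    (fun f hf => φ.lintegral_round_change param' _ _ _ _ hf)
    (fun n h f hf => φ.lintegral_round_change param' _ _ _ _ hf) n hf
  rw [trajLaw, trajLaw, this]
  refine lintegral_congr fun ω => ?_
  rw [← Finset.sum_neg_distrib, Real.exp_sum, ENNReal.ofReal_prod_of_nonneg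
    fun i _ => (Real.exp_pos _).le]
  rfl

lemma lintegral_trajLaw_eval (t : ℕ) {f : S × A × ℝ → ℝ≥0∞} (hf : Measurable f) :
    ∫⁻ ω, f (ω t) ∂(φ.trajLaw π s₁) =
      ∫⁻ ω, ∫⁻ r, f ((ω t).1, (ω t).2.1, r) ∂(F.law (φ.param (ω t).1 (ω t).2.1))
        ∂(φ.trajLaw π s₁) := by
  have hJ : Measurable fun x : S × A × ℝ =>
      ∫⁻ r, f (x.1, x.2.1, r) ∂(F.law (φ.param x.1 x.2.1)) :=
    measurable_of_pair (fun s a => ∫⁻ r, f (s, a, r) ∂(F.law (φ.param s a)))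
      (by fun_prop) (by fun_prop)
  cases t with
  | zero =>
    have h0 : ∀ g : S × A × ℝ → ℝ≥0∞, Measurable g → ∫⁻ ω, g (ω 0) ∂(φ.trajLaw π s₁) =
        ∫⁻ x, g x ∂(φ.round id measurable_id π.init s₁) := fun g hg =>
      lintegral_trajMeasure_zero (f := fun h => g (h ⟨0, Finset.mem_Iic.2 le_rfl⟩)) (by fun_prop)
    rw [h0 f hf, h0 _ hJ, lintegral_round_eq φ _ _ _ _ hf]
  | succ n =>
    have h1 : ∀ g : S × A × ℝ → ℝ≥0∞, Measurable g → ∫⁻ ω, g (ω (n + 1)) ∂(φ.trajLaw π s₁) =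
        ∫⁻ ω, ∫⁻ x, g x ∂(φ.stepKernel π n (Preorder.frestrictLe n ω)) ∂(φ.trajLaw π s₁) :=
      fun g hg => lintegral_trajMeasure_succ n (f := fun p => g p.2) (by fun_prop)
    rw [h1 f hf, h1 _ hJ]
    exact lintegral_congr fun ω => lintegral_round_eq φ _ _ _ _ hf

lemma map_trajLaw_eval (t : ℕ) :
    (φ.trajLaw π s₁).map (fun ω => (((ω t).1, (ω t).2.1), (ω t).2.2)) =
      (φ.trajLaw π s₁).map (fun ω => ((ω t).1, (ω t).2.1)) ⊗ₘ φ.rewardKernel := by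
  refine Measure.ext_of_lintegral _ fun f hf => ?_
  rw [lintegral_map hf (by fun_prop), Measure.lintegral_compProd hf,
    lintegral_map hf.lintegral_kernel_prod_right' (by fun_prop)]
  exact lintegral_trajLaw_eval φ π s₁ t (f := fun x => f ((x.1, x.2.1), x.2.2)) (by fun_prop)

lemma integrable_pair (h : S → A → ℝ) (t : ℕ) :
    Integrable (fun ω => h (ω t).1 (ω t).2.1) (φ.trajLaw π s₁) := by
  have h1 : Integrable (fun p : S × A => h p.1 p.2)
      ((φ.trajLaw π s₁).map (fun ω => ((ω t).1, (ω t).2.1))) := .of_finite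
  exact h1.comp_measurable (by fun_prop)

/-- By the disintegration, a function of the reward may be replaced by its conditional mean given
the pair. Applied to `logRatio`, this turns expected log-likelihood into divergences. -/
lemma integrable_reward {ℓ : S → A → ℝ → ℝ}
    (hm : Measurable fun x : S × A × ℝ => ℓ x.1 x.2.1 x.2.2)
    (hi : ∀ s a, Integrable (ℓ s a) (F.law (φ.param s a))) (t : ℕ) :
    Integrable (fun ω => ℓ (ω t).1 (ω t).2.1 (ω t).2.2) (φ.trajLaw π s₁) ∧
    ∫ ω, ℓ (ω t).1 (ω t).2.1 (ω t).2.2 ∂(φ.trajLaw π s₁) =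
      ∫ ω, (fun s a => ∫ r, ℓ s a r ∂(F.law (φ.param s a))) (ω t).1 (ω t).2.1
        ∂(φ.trajLaw π s₁) := by
  have hm' : Measurable fun x : (S × A) × ℝ => ℓ x.1.1 x.1.2 x.2 :=
    hm.comp (by fun_prop : Measurable fun x : (S × A) × ℝ => (x.1.1, x.1.2, x.2))
  have h1 : Integrable (fun x : (S × A) × ℝ => ℓ x.1.1 x.1.2 x.2)
      ((φ.trajLaw π s₁).map (fun ω => (((ω t).1, (ω t).2.1), (ω t).2.2))) := by
    rw [map_trajLaw_eval, Measure.integrable_compProd_iff hm'.aestronglyMeasurable]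
    exact ⟨ae_of_all _ fun p => hi p.1 p.2, .of_finite⟩
  refine ⟨h1.comp_measurable (by fun_prop), ?_⟩
  have h2 := integral_map (μ := φ.trajLaw π s₁)
    (φ := fun ω => (((ω t).1, (ω t).2.1), (ω t).2.2)) (by fun_prop) h1.aestronglyMeasurable
  rw [← h2, map_trajLaw_eval, Measure.integral_compProd (by rwa [← map_trajLaw_eval]),
    integral_map (by fun_prop) (Measurable.of_discrete).aestronglyMeasurable]
  rfl

omit [MeasurableSpace S] [MeasurableSpace A] [DiscreteMeasurableSpace S]
  [DiscreteMeasurableSpace A] in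
lemma sum_range_eq_sum_visits (h : S → A → ℝ) (T : ℕ) (ω : ℕ → S × A × ℝ) :
    ∑ t ∈ Finset.range T, h (ω t).1 (ω t).2.1 = ∑ s, ∑ a, h s a * visits s a T ω := by
  classical
  have h1 : ∀ s a, h s a * (visits s a T ω : ℝ) =
      ∑ t ∈ Finset.range T, if (ω t).1 = s ∧ (ω t).2.1 = a then h s a else 0 := by
    intro s a
    rw [← Finset.sum_filter, Finset.sum_const, nsmul_eq_mul, mul_comm, visits]
  simp only [h1]
  rw [← Fintype.sum_prod_type', Finset.sum_comm]
  refine Finset.sum_congr rfl fun t _ => ?_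
  rw [Finset.sum_eq_single ((ω t).1, (ω t).2.1)]
  · simp
  · rintro ⟨s, a⟩ _ hne
    rw [if_neg]
    rintro ⟨h1, h2⟩
    exact hne (by simp [h1, h2])
  · simp

omit [Fintype S] [Fintype A] [MeasurableSpace S] [MeasurableSpace A]
  [DiscreteMeasurableSpace S] [DiscreteMeasurableSpace A] in
lemma visits_eq_sum (s : S) (a : A) (T : ℕ) (ω : ℕ → S × A × ℝ) :
    (visits s a T ω : ℝ) =
      ∑ t ∈ Finset.range T, Set.indicator {(s, a)} (fun _ => (1 : ℝ)) ((ω t).1, (ω t).2.1) := by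
  classical
  rw [visits, Finset.card_filter]
  push_cast
  refine Finset.sum_congr rfl fun t _ => ?_
  simp [Set.indicator_apply]

lemma integrable_visits (s : S) (a : A) (T : ℕ) :
    Integrable (fun ω => (visits s a T ω : ℝ)) (φ.trajLaw π s₁) := by
  simp only [visits_eq_sum]
  exact integrable_finsetSum _ fun t _ => φ.integrable_pair π s₁
    (fun s' a' => Set.indicator {(s, a)} (fun _ => (1 : ℝ)) (s', a')) t

lemma expVisits_nonneg (s : S) (a : A) (T : ℕ) : 0 ≤ φ.expVisits π s₁ s a T :=
  integral_nonneg fun _ => Nat.cast_nonneg _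

lemma integral_sum_pair (h : S → A → ℝ) (T : ℕ) :
    ∫ ω, ∑ t ∈ Finset.range T, h (ω t).1 (ω t).2.1 ∂(φ.trajLaw π s₁) =
      ∑ s, ∑ a, h s a * φ.expVisits π s₁ s a T := by
  simp only [sum_range_eq_sum_visits]
  rw [integral_finsetSum _ fun s _ => integrable_finsetSum _ fun a _ =>
    (φ.integrable_visits π s₁ s a T).const_mul _]
  refine Finset.sum_congr rfl fun s _ => ?_
  rw [integral_finsetSum _ fun a _ => (φ.integrable_visits π s₁ s a T).const_mul _]
  exact Finset.sum_congr rfl fun a _ => integral_const_mul _ _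

/-- The information inequality behind the lower bound: bounded functionals of the first `n + 1`
rounds are compared under two processes with the same transitions. -/
lemma integral_sub_integral_exp_le (param' : S → A → F.Θ) (n : ℕ)
    {g : (Finset.Iic n → S × A × ℝ) → ℝ} (hg : Measurable g) {B : ℝ} (hB : ∀ h, |g h| ≤ B) :
    ∫ ω, g (Preorder.frestrictLe n ω) ∂(φ.trajLaw π s₁) -
      ∫ ω, (Real.exp (g (Preorder.frestrictLe n ω)) - 1)
        ∂((⟨φ.next, param'⟩ : DMDP S A F).trajLaw π s₁) ≤
      ∑ s, ∑ a, F.kl (φ.param s a) (param' s a) * φ.expVisits π s₁ s a (n + 1) := by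
  set P := φ.trajLaw π s₁
  set Q := (⟨φ.next, param'⟩ : DMDP S A F).trajLaw π s₁
  set ℓ : S → A → ℝ → ℝ := fun s a => F.logRatio (φ.param s a) (param' s a) with hℓ
  set L : (ℕ → S × A × ℝ) → ℝ := fun ω =>
    ∑ t ∈ Finset.range (n + 1), ℓ (ω t).1 (ω t).2.1 (ω t).2.2 with hL
  have hreward := fun t => φ.integrable_reward π s₁ (ℓ := ℓ)
    (measurable_logRatio_pair φ.param param') (fun s a => F.integrable_logRatio _ _) t
  have hLint : Integrable L P := integrable_finsetSum _ fun t _ => (hreward t).1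
  -- The chain rule for relative entropy: each visit of a pair contributes the divergence of its two
  -- reward laws.
  have hLval : ∫ ω, L ω ∂P =
      ∑ s, ∑ a, F.kl (φ.param s a) (param' s a) * φ.expVisits π s₁ s a (n + 1) := by
    rw [← integral_sum_pair, integral_finsetSum _ fun t _ => (hreward t).1,
      integral_finsetSum _ fun t _ => φ.integrable_pair π s₁
        (fun s a => F.kl (φ.param s a) (param' s a)) t]
    refine Finset.sum_congr rfl fun t _ => ?_
    rw [(hreward t).2]
    simp only [hℓ, ← F.kl_eq_integral]
  have hgm : Measurable fun ω : ℕ → S × A × ℝ => g (Preorder.frestrictLe n ω) := by fun_prop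
  have hgP : Integrable (fun ω => g (Preorder.frestrictLe n ω)) P :=
    Integrable.of_bound hgm.aestronglyMeasurable B (ae_of_all _ fun ω => hB _)
  have hexpQ : Integrable (fun ω => Real.exp (g (Preorder.frestrictLe n ω))) Q := by
    refine Integrable.of_bound hgm.exp.aestronglyMeasurable (Real.exp B) (ae_of_all _ fun ω => ?_)
    rw [Real.norm_eq_abs, Real.abs_exp]
    exact Real.exp_le_exp.2 ((le_abs_self _).trans (hB _))
  have hchange := φ.lintegral_trajLaw_change π s₁ param' n
    (f := fun h => ENNReal.ofReal (Real.exp (g h))) (by fun_prop)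
  have hchange' : ∫⁻ ω, ENNReal.ofReal (Real.exp (g (Preorder.frestrictLe n ω))) ∂Q =
      ∫⁻ ω, ENNReal.ofReal (Real.exp (g (Preorder.frestrictLe n ω) - L ω)) ∂P := by
    rw [hchange]
    refine lintegral_congr fun ω => ?_
    rw [← ENNReal.ofReal_mul (Real.exp_pos _).le, ← Real.exp_add, add_comm, ← sub_eq_add_neg]
  rw [← ofReal_integral_eq_lintegral_ofReal hexpQ (ae_of_all _ fun _ => (Real.exp_pos _).le)]
    at hchange'
  have hmeas : AEStronglyMeasurable
      (fun ω => Real.exp (g (Preorder.frestrictLe n ω) - L ω)) P :=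
    Real.continuous_exp.comp_aestronglyMeasurable (hgP.sub hLint).aestronglyMeasurable
  -- `L` need not be bounded, so integrability is read off from the change of measure, whose `∫⁻`
  -- form requires none: the integral equals that of the bounded `exp g` under `Q`.
  have hexpP : Integrable (fun ω => Real.exp (g (Preorder.frestrictLe n ω) - L ω)) P := by
    refine ⟨hmeas, ?_⟩
    rw [hasFiniteIntegral_iff_ofReal (ae_of_all _ fun _ => (Real.exp_pos _).le), ← hchange']
    exact ENNReal.ofReal_lt_top
  have heq : ∫ ω, Real.exp (g (Preorder.frestrictLe n ω)) ∂Q =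
      ∫ ω, Real.exp (g (Preorder.frestrictLe n ω) - L ω) ∂P := by
    rw [← ofReal_integral_eq_lintegral_ofReal hexpP (ae_of_all _ fun _ => (Real.exp_pos _).le)]
      at hchange'
    exact (ENNReal.ofReal_eq_ofReal_iff (integral_nonneg fun _ => (Real.exp_pos _).le)
      (integral_nonneg fun _ => (Real.exp_pos _).le)).1 hchange'
  -- The inequality `x + 1 ≤ exp x` at `x = g - L` gives a linearized Donsker-Varadhan bound.
  have hmono : ∫ ω, ((g (Preorder.frestrictLe n ω) - L ω) + 1) ∂P ≤
      ∫ ω, Real.exp (g (Preorder.frestrictLe n ω) - L ω) ∂P :=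
    integral_mono ((hgP.sub hLint).add (integrable_const _)) hexpP
      fun ω => Real.add_one_le_exp _
  rw [integral_add (f := fun ω => g (Preorder.frestrictLe n ω) - L ω) (hgP.sub hLint)
    (integrable_const _), integral_sub hgP hLint] at hmono
  rw [integral_sub hexpQ (integrable_const _), heq, ← hLval]
  simp only [integral_const, probReal_univ, smul_eq_mul, one_mul] at hmono ⊢
  linarith

end DMDP

namespace DMDP

/-! ### Optimal cycles and self-loops -/

section Cycles

variable {S A : Type*} {F : ExpFamily} (φ : DMDP S A F)

lemma isSimpleCycle_loop {s : S} {a : A} (h : φ.next s a = s) :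
    φ.IsSimpleCycle (k := 0) (fun _ => (s, a)) :=
  ⟨fun _ => h, fun _ _ _ => Fin.ext (by omega)⟩

lemma gain_loop (s : S) (a : A) : φ.gain (k := 0) (fun _ => (s, a)) = φ.r s a := by
  simp [gain]

/-- A simple cycle containing a self-loop consists of it alone, because consecutive states would
otherwise repeat; the better loop then beats it. -/
lemma loop_notMem_optimalPairs {s s' : S} {a a' : A} (h : φ.next s a = s)
    (h' : φ.next s' a' = s') (hlt : φ.r s a < φ.r s' a') : (s, a) ∉ φ.optimalPairs := by
  rintro ⟨k, c, ⟨⟨hc, hinj⟩, hopt⟩, i, hi⟩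
  have h1 : (c (i + 1)).1 = (c i).1 := by rw [← hc i, hi, h]
  have h2 : i + 1 = i := hinj h1
  have hk : k = 0 := by
    by_contra hk
    have : NeZero k := ⟨hk⟩
    exact absurd (add_eq_left.1 h2) (by simp)
  subst hk
  have h3 : c = fun _ => (s, a) := by
    ext1 j
    rw [← hi, show i = j from Fin.ext (by omega)]
  have h4 := hopt 0 _ (φ.isSimpleCycle_loop h')
  rw [h3, gain_loop, gain_loop] at h4
  exact absurd h4 (not_le.2 hlt)

/-- An optimal cycle has gain at least `r s b`, the maximal reward, so every one of its pairs leads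
into `s`. Hence so does the predecessor of each pair, and the pair itself starts at `s`. -/
lemma eq_of_mem_optimalPairs {s : S} {b : A} (hb : φ.next s b = s)
    (hle : ∀ x a, φ.r x a ≤ φ.r s b) (hlt : ∀ x a, φ.next x a ≠ s → φ.r x a < φ.r s b)
    {x : S} {a : A} (hx : (x, a) ∈ φ.optimalPairs) : x = s ∧ φ.next x a = s := by
  obtain ⟨k, c, ⟨⟨hc, -⟩, hopt⟩, i, hi⟩ := hx
  have h1 := hopt 0 _ (φ.isSimpleCycle_loop hb)
  have hpos : (0 : ℝ) < (k + 1 : ℕ) := by positivity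
  rw [gain_loop, gain, le_div_iff₀ hpos] at h1
  have h2 : ∀ j, φ.next (c j).1 (c j).2 = s := by
    intro j
    by_contra hj
    have h3 : ∑ i, φ.r (c i).1 (c i).2 < ∑ _i : Fin (k + 1), φ.r s b :=
      Finset.sum_lt_sum (fun i _ => hle _ _) ⟨j, Finset.mem_univ _, hlt _ _ hj⟩
    rw [Finset.sum_const, Finset.card_univ, Fintype.card_fin, nsmul_eq_mul, mul_comm] at h3
    exact absurd h1 (not_le.2 h3)
  have h4 : (c i).1 = s := by
    have := hc (i - 1)
    rw [sub_add_cancel, h2] at this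
    exact this.symm
  have h5 := h2 i
  rw [hi] at h4 h5
  exact ⟨h4, h5⟩

end Cycles

/-! ### Deterministic policies and the optimal value -/

variable {S A : Type*} [Fintype S] [Fintype A] [MeasurableSpace S] [MeasurableSpace A]
  [DiscreteMeasurableSpace S] [DiscreteMeasurableSpace A] {F : ExpFamily} (φ : DMDP S A F)

/-- The deterministic policy that plays `g t s` in round `t` in state `s`. -/
def markovPolicy (g : ℕ → S → A) : Policy S A where
  init := Kernel.deterministic (g 0) .of_discrete
  step n := Kernel.deterministic (fun p => g (n + 1) p.2)
    ((Measurable.of_discrete (f := g (n + 1))).comp measurable_snd)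
  isMarkov_init := inferInstance
  isMarkov_step := fun _ => inferInstance

/-- The states visited under `markovPolicy g`. -/
def path (g : ℕ → S → A) (s₁ : S) : ℕ → S
  | 0 => s₁
  | t + 1 => φ.next (path g s₁ t) (g t (path g s₁ t))

lemma measurableSet_pair (s : S) (a : A) :
    MeasurableSet {x : S × A × ℝ | x.1 = s ∧ x.2.1 = a} :=
  (measurableSet_eq_fun measurable_fst measurable_const).inter
    (measurableSet_eq_fun (measurable_fst.comp measurable_snd) measurable_const)

lemma ae_trajLaw_markovPolicy (g : ℕ → S → A) (s₁ : S) (t : ℕ) :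
    ∀ᵐ ω ∂(φ.trajLaw (markovPolicy g) s₁),
      (ω t).1 = φ.path g s₁ t ∧ (ω t).2.1 = g t (φ.path g s₁ t) := by
  have key : ∀ (t : ℕ), ∫⁻ ω, Set.indicator {x : S × A × ℝ | x.1 = φ.path g s₁ t ∧
      x.2.1 = g t (φ.path g s₁ t)}ᶜ (fun _ => (1 : ℝ≥0∞)) (ω t)
        ∂(φ.trajLaw (markovPolicy g) s₁) = 0 →
      ∀ᵐ ω ∂(φ.trajLaw (markovPolicy g) s₁),
        (ω t).1 = φ.path g s₁ t ∧ (ω t).2.1 = g t (φ.path g s₁ t) := by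
    intro t h
    have hm : Measurable fun ω : ℕ → S × A × ℝ => Set.indicator {x : S × A × ℝ |
        x.1 = φ.path g s₁ t ∧ x.2.1 = g t (φ.path g s₁ t)}ᶜ (fun _ => (1 : ℝ≥0∞)) (ω t) :=
      (measurable_const.indicator (measurableSet_pair _ _).compl).comp (measurable_pi_apply t)
    rw [lintegral_eq_zero_iff hm] at h
    filter_upwards [h] with ω hω
    by_contra hne
    rw [Pi.zero_apply, Set.indicator_of_mem (by exact hne)] at hω
    exact one_ne_zero hω
  have hmB : ∀ t, Measurable (Set.indicator {x : S × A × ℝ | x.1 = φ.path g s₁ t ∧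
      x.2.1 = g t (φ.path g s₁ t)}ᶜ (fun _ => (1 : ℝ≥0∞))) := fun t =>
    measurable_const.indicator (measurableSet_pair _ _).compl
  induction t with
  | zero =>
    refine key 0 ?_
    have h0 := lintegral_trajMeasure_zero (μ₀ := φ.round id measurable_id (markovPolicy g).init s₁)
      (κ := φ.stepKernel (markovPolicy g)) (f := fun h => Set.indicator {x : S × A × ℝ |
        x.1 = φ.path g s₁ 0 ∧ x.2.1 = g 0 (φ.path g s₁ 0)}ᶜ (fun _ => (1 : ℝ≥0∞))
          (h ⟨0, Finset.mem_Iic.2 le_rfl⟩)) ((hmB 0).comp (measurable_pi_apply _))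
    refine h0.trans ?_
    rw [lintegral_round _ _ _ _ _ (hmB 0)]
    simp [markovPolicy, path, Kernel.deterministic_apply]
  | succ t ih =>
    refine key (t + 1) ?_
    refine (lintegral_trajMeasure_succ t (f := fun p => Set.indicator {x : S × A × ℝ |
        x.1 = φ.path g s₁ (t + 1) ∧ x.2.1 = g (t + 1) (φ.path g s₁ (t + 1))}ᶜ
          (fun _ => (1 : ℝ≥0∞)) p.2) ((hmB (t + 1)).comp measurable_snd)).trans ?_
    rw [← lintegral_zero]
    refine lintegral_congr_ae ?_
    filter_upwards [ih] with ω hω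
    have hcur : φ.current (Preorder.frestrictLe (π := fun _ => S × A × ℝ) t ω) =
        φ.path g s₁ (t + 1) := by
      simp only [current, Preorder.frestrictLe_apply, hω.1, hω.2, path]
    rw [stepKernel, lintegral_round _ _ _ _ _ (hmB (t + 1)), hcur]
    simp [markovPolicy, Kernel.comap_apply, Kernel.deterministic_apply, hcur]

lemma value_markovPolicy (g : ℕ → S → A) (s₁ : S) (T : ℕ) :
    φ.value (markovPolicy g) s₁ T =
      ∑ t ∈ Finset.range T, φ.r (φ.path g s₁ t) (g t (φ.path g s₁ t)) := by
  rw [value, integral_congr_ae (g := fun _ => ∑ t ∈ Finset.range T,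
    φ.r (φ.path g s₁ t) (g t (φ.path g s₁ t)))]
  · simp
  · filter_upwards [ae_all_iff.2 (φ.ae_trajLaw_markovPolicy g s₁)] with ω hω
    exact Finset.sum_congr rfl fun t _ => by rw [(hω t).1, (hω t).2]

lemma sum_expVisits (π : Policy S A) (s₁ : S) (T : ℕ) :
    ∑ s, ∑ a, φ.expVisits π s₁ s a T = T := by
  have := φ.integral_sum_pair π s₁ (fun _ _ => 1) T
  simpa using this.symm

lemma value_eq (π : Policy S A) (s₁ : S) (T : ℕ) :
    φ.value π s₁ T = ∑ s, ∑ a, φ.r s a * φ.expVisits π s₁ s a T :=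
  φ.integral_sum_pair π s₁ _ T

lemma mul_sub_value_eq (π : Policy S A) (s₁ : S) (T : ℕ) (ρ : ℝ) :
    T * ρ - φ.value π s₁ T = ∑ s, ∑ a, (ρ - φ.r s a) * φ.expVisits π s₁ s a T := by
  rw [value_eq, ← φ.sum_expVisits π s₁ T]
  simp only [sub_mul, Finset.sum_sub_distrib, Finset.sum_mul, mul_comm ρ]

lemma value_le {ρ : ℝ} (hρ : ∀ s a, φ.r s a ≤ ρ) (π : Policy S A) (s₁ : S) (T : ℕ) :
    φ.value π s₁ T ≤ T * ρ := by
  have h := φ.mul_sub_value_eq π s₁ T ρ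
  have : 0 ≤ ∑ s, ∑ a, (ρ - φ.r s a) * φ.expVisits π s₁ s a T :=
    Finset.sum_nonneg fun s _ => Finset.sum_nonneg fun a _ =>
      mul_nonneg (sub_nonneg.2 (hρ s a)) (φ.expVisits_nonneg π s₁ s a T)
  linarith

/-- If an optimal self-loop is reachable, the optimal value is the optimal gain times the horizon,
up to a constant. -/
lemma exists_le_optValue (hcomm : φ.Communicating) {s : S} {b : A} (hb : φ.next s b = s)
    (hle : ∀ x a, φ.r x a ≤ φ.r s b) (s₁ : S) :
    ∃ C : ℝ, ∀ T : ℕ, T * φ.r s b - C ≤ φ.optValue s₁ T := by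
  classical
  obtain ⟨μ, n, hn⟩ := hcomm s₁ s
  -- Walk to `s` during the first `n` rounds, then stay there; the constant `C` is the loss during
  -- the walk.
  set g : ℕ → S → A := fun t x => if t < n then μ x else b with hg
  have hpath1 : ∀ t ≤ n, φ.path g s₁ t = (fun x => φ.next x (μ x))^[t] s₁ := by
    intro t
    induction t with
    | zero => intro; rfl
    | succ t ih =>
      intro ht
      rw [path, ih (by omega), Function.iterate_succ_apply']
      simp [hg, show t < n by omega]
  have hpath2 : ∀ t, n ≤ t → φ.path g s₁ t = s := by
    intro t ht
    induction t, ht using Nat.le_induction with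
    | base => rw [hpath1 n le_rfl, hn]
    | succ t ht ih => rw [path, ih]; simp [hg, show ¬ t < n by omega, hb]
  set f : ℕ → ℝ := fun t => φ.r s b - φ.r (φ.path g s₁ t) (g t (φ.path g s₁ t)) with hf
  have hf0 : ∀ t, 0 ≤ f t := fun t => sub_nonneg.2 (hle _ _)
  have hfn : ∀ t, n ≤ t → f t = 0 := fun t ht => by
    have hgt : g t s = b := by simp [hg, show ¬ t < n by omega]
    simp only [hf, hpath2 t ht, hgt, sub_self]
  refine ⟨∑ t ∈ Finset.range n, f t, fun T => ?_⟩
  have h1 : ∑ t ∈ Finset.range T, f t ≤ ∑ t ∈ Finset.range n, f t := by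
    have h2 : ∑ t ∈ Finset.range (max T n), f t = ∑ t ∈ Finset.range n, f t := by
      refine (Finset.sum_subset (Finset.range_mono (le_max_right _ _)) fun t _ ht => ?_).symm
      exact hfn t (by simpa using ht)
    rw [← h2]
    exact Finset.sum_le_sum_of_subset_of_nonneg (Finset.range_mono (le_max_left _ _))
      fun t _ _ => hf0 t
  have h3 : ∑ t ∈ Finset.range T, f t = T * φ.r s b - φ.value (markovPolicy g) s₁ T := by
    simp [hf, value_markovPolicy]
  have h4 : φ.value (markovPolicy g) s₁ T ≤ φ.optValue s₁ T := by
    -- The real supremum is meaningful only for a bounded family; no policy earns more than `T * r s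
    -- b`.
    refine le_ciSup (f := fun π : Policy S A => φ.value π s₁ T) ⟨T * φ.r s b, ?_⟩ _
    rintro _ ⟨π, rfl⟩
    exact φ.value_le hle π s₁ T
  linarith

end DMDP

/-! ### Lower bound on the number of entries into a state -/

namespace DMDP

variable {S A : Type*} [Fintype S] [Fintype A] [MeasurableSpace S] [MeasurableSpace A]
  [DiscreteMeasurableSpace S] [DiscreteMeasurableSpace A] {F : ExpFamily}

/-- A finite-time bound comparing the fractions of time spent outside a set of pairs (with
indicator function `u`) under two processes with the same transitions. -/
lemma mul_expVisits_sub_le (φ : DMDP S A F) (π : Policy S A) (s₁ : S) (param' : S → A → F.Θ)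
    {u : S → A → ℝ} (hu0 : ∀ s a, 0 ≤ u s a) (hu1 : ∀ s a, u s a ≤ 1) {T : ℕ} (hT : 0 < T)
    (c : ℝ) :
    c * ((∑ s, ∑ a, u s a * φ.expVisits π s₁ s a T) / T) - (Real.exp c - 1) *
        ((∑ s, ∑ a, u s a * (⟨φ.next, param'⟩ : DMDP S A F).expVisits π s₁ s a T) / T) ≤
      ∑ s, ∑ a, F.kl (φ.param s a) (param' s a) * φ.expVisits π s₁ s a T := by
  obtain ⟨n, rfl⟩ : ∃ n, T = n + 1 := ⟨T - 1, by omega⟩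
  have hTpos : (0 : ℝ) < (n + 1 : ℕ) := by positivity
  set U : (Finset.Iic n → S × A × ℝ) → ℝ :=
    fun h => (∑ t : Finset.Iic n, u (h t).1 (h t).2.1) / (n + 1 : ℕ) with hU
  have hUm : Measurable U := by
    refine (Finset.measurable_sum _ fun t _ => ?_).div_const _
    exact measurable_of_pair u (by fun_prop) (by fun_prop)
  have hU0 : ∀ h, 0 ≤ U h := fun h =>
    div_nonneg (Finset.sum_nonneg fun t _ => hu0 _ _) hTpos.le
  have hU1 : ∀ h, U h ≤ 1 := fun h => by
    rw [hU, div_le_one hTpos]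
    refine (Finset.sum_le_sum fun t _ => hu1 _ _).trans ?_
    simp
  have hUω : ∀ ω : ℕ → S × A × ℝ, U (Preorder.frestrictLe (π := fun _ => S × A × ℝ) n ω) =
      (∑ t ∈ Finset.range (n + 1), u (ω t).1 (ω t).2.1) / (n + 1 : ℕ) := by
    intro ω
    have h1 : Finset.range (n + 1) = Finset.Iic n := by ext; simp
    rw [h1]
    refine congrArg (· / ((n + 1 : ℕ) : ℝ)) ?_
    exact Finset.sum_coe_sort (Finset.Iic n) (fun t => u (ω t).1 (ω t).2.1)
  have hUint : ∀ ψ : DMDP S A F, ∫ ω, U (Preorder.frestrictLe n ω) ∂(ψ.trajLaw π s₁) =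
      (∑ s, ∑ a, u s a * ψ.expVisits π s₁ s a (n + 1)) / (n + 1 : ℕ) := by
    intro ψ
    simp only [hUω]
    rw [integral_div, integral_sum_pair]
  have hUI : ∀ ψ : DMDP S A F,
      Integrable (fun ω => U (Preorder.frestrictLe n ω)) (ψ.trajLaw π s₁) := fun ψ =>
    Integrable.of_bound (hUm.comp (by fun_prop)).aestronglyMeasurable 1 (ae_of_all _ fun ω => by
      rw [Real.norm_eq_abs, abs_of_nonneg (hU0 _)]; exact hU1 _)
  have hmain := φ.integral_sub_integral_exp_le π s₁ param' n (g := fun h => c * U h)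
    (hUm.const_mul c) (B := |c|) (fun h => by
      rw [abs_mul, abs_of_nonneg (hU0 h)]
      exact mul_le_of_le_one_right (abs_nonneg c) (hU1 h))
  -- The chord of the convex function `exp` between `0` and `c` makes the exponential term linear in
  -- the fraction `U`, so that expected visits suffice.
  have hconv : ∀ h, Real.exp (c * U h) - 1 ≤ (Real.exp c - 1) * U h := by
    intro h
    have := convexOn_exp.2 (Set.mem_univ 0) (Set.mem_univ c)
      (sub_nonneg.2 (hU1 h)) (hU0 h) (sub_add_cancel 1 (U h))
    simp only [smul_eq_mul, mul_zero, zero_add, Real.exp_zero, mul_one] at this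
    rw [mul_comm c]
    linarith
  have hexp : ∫ ω, (Real.exp (c * U (Preorder.frestrictLe n ω)) - 1)
      ∂((⟨φ.next, param'⟩ : DMDP S A F).trajLaw π s₁) ≤
      (Real.exp c - 1) * ∫ ω, U (Preorder.frestrictLe n ω)
        ∂((⟨φ.next, param'⟩ : DMDP S A F).trajLaw π s₁) := by
    rw [← integral_const_mul]
    refine integral_mono (Integrable.sub ?_ (integrable_const _)) ((hUI _).const_mul _)
      fun ω => hconv _
    refine Integrable.of_bound
      ((hUm.const_mul c).exp.comp (by fun_prop)).aestronglyMeasurable (Real.exp |c|)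
      (ae_of_all _ fun ω => ?_)
    rw [Real.norm_eq_abs, Real.abs_exp]
    refine Real.exp_le_exp.2 ((le_abs_self _).trans ?_)
    rw [abs_mul, abs_of_nonneg (hU0 _)]
    exact mul_le_of_le_one_right (abs_nonneg c) (hU1 _)
  rw [integral_const_mul, hUint] at hmain
  rw [hUint] at hexp
  linarith

/-- The expected number of rounds, among the first `T`, that lead to the state `s`. -/
def expEntries [DecidableEq S] (φ : DMDP S A F) (π : Policy S A) (s₁ s : S) (T : ℕ) : ℝ :=
  ∑ x, ∑ a, if φ.next x a = s then φ.expVisits π s₁ x a T else 0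

variable [DecidableEq S]

lemma expEntries_nonneg (φ : DMDP S A F) (π : Policy S A) (s₁ s : S) (T : ℕ) :
    0 ≤ φ.expEntries π s₁ s T :=
  Finset.sum_nonneg fun x _ => Finset.sum_nonneg fun a _ => by
    split_ifs
    exacts [φ.expVisits_nonneg π s₁ x a T, le_rfl]

lemma sum_mul_expEntries (φ : DMDP S A F) (π : Policy S A) (s₁ : S) (h : S → ℝ) (T : ℕ) :
    ∑ x, ∑ a, h (φ.next x a) * φ.expVisits π s₁ x a T = ∑ s, h s * φ.expEntries π s₁ s T := by
  simp only [expEntries, Finset.mul_sum, mul_ite, mul_zero]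
  symm
  rw [Finset.sum_comm]
  refine Finset.sum_congr rfl fun x _ => ?_
  rw [Finset.sum_comm]
  exact Finset.sum_congr rfl fun a _ => by simp

/-- If the rounds spent off the self-loops of `s` are asymptotically all rounds under `φ`, and are
`o(T ^ α)` when the reward parameter of `s` is changed to `lam`, then `s` is entered at least
`(1 - 3 α) log T / kl` times under `φ`. -/
lemma eventually_le_expEntries {next : S → A → S} (θ : S → F.Θ) (π : Policy S A) (s₁ s : S)
    (lam : F.Θ) {α : ℝ} (hα0 : 0 < α) (hα1 : α ≤ 1)
    (hloop : ∀ a, next s a = s → (fun T : ℕ =>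
      (stateDependent next θ : DMDP S A F).expVisits π s₁ s a T) =o[atTop] fun T : ℕ => (T : ℝ))
    (hoff : ∀ x a, ¬ (x = s ∧ next x a = s) → (fun T : ℕ =>
      (stateDependent next (Function.update θ s lam) : DMDP S A F).expVisits π s₁ x a T)
        =o[atTop] fun T : ℕ => (T : ℝ) ^ α) :
    ∀ᶠ T : ℕ in atTop, (1 - 3 * α) * Real.log T ≤
      F.kl (θ s) lam * (stateDependent next θ : DMDP S A F).expEntries π s₁ s T := by
  set φ : DMDP S A F := stateDependent next θ with hφ
  set ψ : DMDP S A F := stateDependent next (Function.update θ s lam) with hψ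
  set u : S → A → ℝ := fun x a => if x = s ∧ next x a = s then 0 else 1 with hu
  have hu0 : ∀ x a, 0 ≤ u x a := fun x a => by simp only [hu]; split_ifs <;> norm_num
  have hu1 : ∀ x a, u x a ≤ 1 := fun x a => by simp only [hu]; split_ifs <;> norm_num
  have hon : (fun T : ℕ => ∑ x, ∑ a, (1 - u x a) * φ.expVisits π s₁ x a T)
      =o[atTop] fun T : ℕ => (T : ℝ) := by
    refine IsLittleO.fun_sum fun x _ => IsLittleO.fun_sum fun a _ => ?_
    by_cases h : x = s ∧ next x a = s
    · obtain ⟨rfl, h⟩ := h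
      simpa [hu, h] using hloop a h
    · simp [hu, h]
  have hoff' : (fun T : ℕ => ∑ x, ∑ a, u x a * ψ.expVisits π s₁ x a T)
      =o[atTop] fun T : ℕ => (T : ℝ) ^ α := by
    refine IsLittleO.fun_sum fun x _ => IsLittleO.fun_sum fun a _ => ?_
    by_cases h : x = s ∧ next x a = s
    · simp only [hu, if_pos h, zero_mul]
      exact isLittleO_zero _ _
    · simpa [hu, h] using hoff x a h
  -- An additive error `1` appears below; for these `T` it is at most `α * log T`.
  have hlog : ∀ᶠ T : ℕ in atTop, 1 / α ≤ Real.log T :=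
    (Real.tendsto_log_atTop.comp tendsto_natCast_atTop_atTop).eventually_ge_atTop _
  filter_upwards [hon.bound hα0, hoff'.bound one_pos, hlog, eventually_gt_atTop 0]
    with T h1 h2 h3 hT
  have hT' : (0 : ℝ) < T := by exact_mod_cast hT
  have h3' : 1 ≤ α * Real.log T := by
    rwa [div_le_iff₀ hα0, mul_comm] at h3
  have hlog0 : 0 ≤ Real.log T := by
    by_contra h
    have := mul_neg_of_pos_of_neg hα0 (not_le.1 h)
    linarith
  -- The two processes differ only on the pairs leading to `s`, and by the same divergence on each.
  have hkl : ∑ x, ∑ a, F.kl (φ.param x a) (ψ.param x a) * φ.expVisits π s₁ x a T =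
      F.kl (θ s) lam * φ.expEntries π s₁ s T := by
    rw [expEntries, Finset.mul_sum]
    refine Finset.sum_congr rfl fun x _ => ?_
    rw [Finset.mul_sum]
    refine Finset.sum_congr rfl fun a _ => ?_
    by_cases h : next x a = s
    · simp [hφ, hψ, stateDependent, h]
    · simp [hφ, hψ, stateDependent, h, F.kl_self]
  -- With this `c`, `exp c * T ^ α = T`, so the term coming from `ψ` is at most `1`. The fraction
  -- under `φ` is at least `1 - α`, which leaves `(1 - α) ^ 2 * log T - 1`.
  have hfin := φ.mul_expVisits_sub_le π s₁ ψ.param hu0 hu1 hT ((1 - α) * Real.log T)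
  rw [hkl] at hfin
  refine le_trans ?_ hfin
  change _ ≤ (1 - α) * Real.log T * ((∑ x, ∑ a, u x a * φ.expVisits π s₁ x a T) / T) -
    (Real.exp ((1 - α) * Real.log T) - 1) *
      ((∑ x, ∑ a, u x a * ψ.expVisits π s₁ x a T) / T)
  have hsum : ∑ x, ∑ a, (1 - u x a) * φ.expVisits π s₁ x a T =
      T - ∑ x, ∑ a, u x a * φ.expVisits π s₁ x a T := by
    rw [← φ.sum_expVisits π s₁ T]
    simp only [sub_mul, one_mul, Finset.sum_sub_distrib]
  rw [hsum, Real.norm_of_nonneg hT'.le] at h1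
  have hx : 1 - α ≤ (∑ x, ∑ a, u x a * φ.expVisits π s₁ x a T) / T := by
    rw [le_div_iff₀ hT']
    linarith [le_of_abs_le h1]
  rw [Real.norm_of_nonneg (Real.rpow_nonneg hT'.le α), one_mul] at h2
  set y := ∑ x, ∑ a, u x a * ψ.expVisits π s₁ x a T
  have hy0 : 0 ≤ y := Finset.sum_nonneg fun x _ => Finset.sum_nonneg fun a _ =>
    mul_nonneg (hu0 x a) (ψ.expVisits_nonneg π s₁ x a T)
  have hexp : Real.exp ((1 - α) * Real.log T) * (T : ℝ) ^ α = T := by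
    rw [Real.rpow_def_of_pos hT', ← Real.exp_add]
    ring_nf
    exact Real.exp_log hT'
  have hy : (Real.exp ((1 - α) * Real.log T) - 1) * (y / T) ≤ 1 := by
    have h4 : Real.exp ((1 - α) * Real.log T) * y ≤ T := by
      exact (mul_le_mul_of_nonneg_left (le_of_abs_le h2) (Real.exp_pos _).le).trans_eq hexp
    have h5 : Real.exp ((1 - α) * Real.log T) * (y / T) ≤ 1 := by
      rw [← mul_div_assoc, div_le_one hT']; exact h4
    have h6 : 0 ≤ y / T := div_nonneg hy0 hT'.le
    linarith
  have hz : (1 - α) * Real.log T * (1 - α) ≤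
      (1 - α) * Real.log T * ((∑ x, ∑ a, u x a * φ.expVisits π s₁ x a T) / T) :=
    mul_le_mul_of_nonneg_left hx (mul_nonneg (by linarith) hlog0)
  have hw : 0 ≤ α ^ 2 * Real.log T := by positivity
  linarith

end DMDP

/-! ### Uniformly good policies and the regret -/

namespace DMDP

variable {S A : Type*} [Fintype S] [Fintype A] [MeasurableSpace S] [MeasurableSpace A]
  [DiscreteMeasurableSpace S] [DiscreteMeasurableSpace A] [DecidableEq S] {F : ExpFamily}

/-- Under a uniformly good policy, a suboptimal state `s` is entered at least
`(1 - δ) log T / KL` times. -/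
lemma eventually_le_expEntries_of_uniformlyGood {Φ : Set (DMDP S A F)} {π : Policy S A}
    (hπ : UniformlyGood Φ π) {next : S → A → S} (hstay : ∀ s, ∃ a, next s a = s)
    (hΦ : ∀ θ' : S → F.Θ, stateDependent next θ' ∈ Φ) (θ : S → F.Θ) {sStar : S}
    (hstar : ∀ s, F.mean (θ s) ≤ F.mean (θ sStar)) {s : S}
    (hs : F.mean (θ s) < F.mean (θ sStar)) (s₁ : S) {δ : ℝ} (hδ0 : 0 < δ) (hδ1 : δ ≤ 1) :
    ∀ᶠ T : ℕ in atTop, (1 - δ) * Real.log T / F.kl (θ s) (θ sStar) ≤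
      (stateDependent next θ : DMDP S A F).expEntries π s₁ s T := by
  have hkl : 0 < F.kl (θ s) (θ sStar) := F.kl_pos fun h => hs.ne (congrArg F.mean h)
  obtain ⟨lam, hlam, hK⟩ := F.exists_gt_kl_lt (θ s) (θ sStar)
    (K := (1 + δ / 2) * F.kl (θ s) (θ sStar)) (by nlinarith)
  have hmean : ∀ x, F.mean (θ x) < F.mean lam := fun x =>
    (hstar x).trans_lt (F.mean_strictMono hlam)
  -- The exponent `δ / 6` gives the factor `1 - δ / 2`, and `(1 + δ / 2) * (1 - δ) ≤ 1 - δ / 2`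
  -- absorbs the excess divergence of `lam`.
  have hev := DMDP.eventually_le_expEntries (next := next) θ π s₁ s lam (α := δ / 6)
    (by linarith) (by linarith) ?_ ?_
  · filter_upwards [hev, eventually_ge_atTop 1] with T hT hT1
    have hlog : 0 ≤ Real.log T := Real.log_nonneg (by exact_mod_cast hT1)
    set M := (stateDependent next θ : DMDP S A F).expEntries π s₁ s T with hM
    have hM0 : 0 ≤ M := expEntries_nonneg _ _ _ _ _
    rw [div_le_iff₀ hkl]
    have h1 : (1 - δ / 2) * Real.log T ≤ (1 + δ / 2) * (M * F.kl (θ s) (θ sStar)) := by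
      have := mul_le_mul_of_nonneg_right hK.le hM0
      calc (1 - δ / 2) * Real.log T = (1 - 3 * (δ / 6)) * Real.log T := by ring
        _ ≤ F.kl (θ s) lam * M := hT
        _ ≤ _ := this
        _ = _ := by ring
    have h2 : (1 + δ / 2) * ((1 - δ) * Real.log T) ≤ (1 - δ / 2) * Real.log T := by
      have : 0 ≤ δ ^ 2 * Real.log T := by positivity
      linarith
    exact le_of_mul_le_mul_left (h2.trans h1) (by linarith)
  -- In the true process the self-loops of `s` lose to one at `sStar`; here the exponent `1` is
  -- enough.
  · intro a ha
    obtain ⟨b, hb⟩ := hstay sStar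
    have := hπ _ (hΦ θ) s₁ 1 one_pos s a (loop_notMem_optimalPairs _ ha hb (by
      simpa [r, stateDependent, ha, hb] using hs))
    simpa only [Real.rpow_one] using this
  -- In the modified process `s` alone has the largest mean, so only its self-loops are optimal.
  · intro x a hxa
    obtain ⟨b, hb⟩ := hstay s
    refine hπ _ (hΦ _) s₁ (δ / 6) (by linarith) x a fun hmem => hxa ?_
    have hb' : (stateDependent next (Function.update θ s lam) : DMDP S A F).r s b = F.mean lam := by
      simp [r, stateDependent, hb]
    have hlt : ∀ x a, next x a ≠ s →
        (stateDependent next (Function.update θ s lam) : DMDP S A F).r x a < F.mean lam := by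
      intro x a h
      simpa [r, stateDependent, h] using hmean _
    refine eq_of_mem_optimalPairs _ (b := b) hb (fun x a => ?_) (fun x a h => ?_) hmem
    · rw [hb']
      by_cases h : next x a = s
      · simp [r, stateDependent, h]
      · exact (hlt x a h).le
    · rw [hb']
      exact hlt x a h

/-- The regret is, up to a constant, a combination of the numbers of entries into the states. -/
lemma exists_le_regret {next : S → A → S} (θ : S → F.Θ)
    (hcomm : (stateDependent next θ : DMDP S A F).Communicating)
    (hstay : ∀ s, ∃ a, next s a = s) {sStar : S}
    (hstar : ∀ s, F.mean (θ s) ≤ F.mean (θ sStar)) (π : Policy S A) (s₁ : S) :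
    ∃ C : ℝ, ∀ T : ℕ, ∑ s, (F.mean (θ sStar) - F.mean (θ s)) *
        (stateDependent next θ : DMDP S A F).expEntries π s₁ s T - C ≤
      (stateDependent next θ : DMDP S A F).regret π s₁ T := by
  obtain ⟨b, hb⟩ := hstay sStar
  have hr : (stateDependent next θ : DMDP S A F).r sStar b = F.mean (θ sStar) := by
    simp [r, stateDependent, hb]
  obtain ⟨C, hC⟩ := exists_le_optValue (stateDependent next θ : DMDP S A F) hcomm (s := sStar)
    (b := b) hb (fun x a => by rw [hr]; exact hstar _) s₁
  refine ⟨C, fun T => ?_⟩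
  have h1 := hC T
  have h2 := mul_sub_value_eq (stateDependent next θ : DMDP S A F) π s₁ T (F.mean (θ sStar))
  have h3 := sum_mul_expEntries (stateDependent next θ : DMDP S A F) π s₁
    (fun s => F.mean (θ sStar) - F.mean (θ s)) T
  rw [← h3, regret]
  rw [hr] at h1
  have h4 : ∑ x, ∑ a, (F.mean (θ sStar) - F.mean (θ ((stateDependent next θ : DMDP S A F).next x a)))
      * (stateDependent next θ : DMDP S A F).expVisits π s₁ x a T =
      T * F.mean (θ sStar) - (stateDependent next θ : DMDP S A F).value π s₁ T := h2.symm
  linarith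

end DMDP

end DetMDP

end

/-! ### The logarithmic regret bound -/

theorem corollary2 {S A : Type*} [Fintype S] [DecidableEq S] [Fintype A]
    [MeasurableSpace S] [DiscreteMeasurableSpace S]
    [MeasurableSpace A] [DiscreteMeasurableSpace A]
    (F : DetMDP.ExpFamily)
    (Φ : Set (DetMDP.DMDP S A F)) (π : DetMDP.Policy S A) (hπ : DetMDP.UniformlyGood Φ π)
    (φ : DetMDP.DMDP S A F) (hcomm : φ.Communicating)
    (hstay : ∀ s : S, ∃ a : A, φ.next s a = s)
    -- `Φ` contains all processes with the transitions of `φ` and state-dependent rewards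
    (hΦ : ∀ θ' : S → F.Θ, DetMDP.DMDP.stateDependent φ.next θ' ∈ Φ)
    -- `φ` has state-dependent rewards
    (θ : S → F.Θ) (hφ : ∀ (s : S) (a : A), φ.param s a = θ (φ.next s a))
    -- `sStar` is an optimal state
    (sStar : S) (hstar : ∀ s : S, F.mean (θ s) ≤ F.mean (θ sStar))
    (s₁ : S) :
    ((∑ s ∈ Finset.univ.erase sStar,
        (F.mean (θ sStar) - F.mean (θ s)) / F.kl (θ s) (θ sStar) : ℝ) : EReal) ≤
      Filter.liminf (fun T : ℕ => ((φ.regret π s₁ T / Real.log T : ℝ) : EReal))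
        Filter.atTop := by
  obtain ⟨next, param⟩ := φ
  obtain rfl : param = fun s a => θ (next s a) := by
    ext s a
    exact congrArg Subtype.val (hφ s a)
  change _ ≤ Filter.liminf (fun T : ℕ =>
    (((DetMDP.DMDP.stateDependent next θ : DetMDP.DMDP S A F).regret π s₁ T / Real.log T : ℝ) :
      EReal)) Filter.atTop
  set Z := ∑ s ∈ Finset.univ.erase sStar,
    (F.mean (θ sStar) - F.mean (θ s)) / F.kl (θ s) (θ sStar) with hZ
  have hZ0 : 0 ≤ Z := Finset.sum_nonneg fun s _ =>
    div_nonneg (sub_nonneg.2 (hstar s)) (F.kl_nonneg _ _)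
  obtain ⟨C, hC⟩ := DetMDP.DMDP.exists_le_regret θ hcomm hstay hstar π s₁
  refine le_of_forall_lt fun c hc => ?_
  obtain ⟨q, hcq, hqZ⟩ := EReal.lt_iff_exists_real_btwn.1 hc
  refine hcq.trans_le (Filter.le_liminf_of_le (by isBoundedDefault) ?_)
  rw [EReal.coe_lt_coe_iff] at hqZ
  -- Chosen so that `(1 - δ) * Z - δ ≥ q`: one `δ` shrinks the entry counts, the other pays for the
  -- constant `C` once `C ≤ δ * log T`.
  set δ := min 1 ((Z - q) / (Z + 1)) with hδ
  have hδ0 : 0 < δ := lt_min one_pos (div_pos (by linarith) (by linarith))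
  have hδZ : δ * (Z + 1) ≤ Z - q := by
    rw [← le_div_iff₀ (by linarith)]
    exact min_le_right _ _
  have hall : ∀ᶠ T : ℕ in Filter.atTop, ∀ s,
      (F.mean (θ sStar) - F.mean (θ s)) * ((1 - δ) * Real.log T / F.kl (θ s) (θ sStar)) ≤
      (F.mean (θ sStar) - F.mean (θ s)) *
        (DetMDP.DMDP.stateDependent next θ : DetMDP.DMDP S A F).expEntries π s₁ s T := by
    refine Filter.eventually_all.2 fun s => ?_
    rcases (hstar s).lt_or_eq with hs | hs
    · filter_upwards [DetMDP.DMDP.eventually_le_expEntries_of_uniformlyGood hπ hstay hΦ θ hstar hs s₁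
        hδ0 (min_le_left _ _)] with T hT
      exact mul_le_mul_of_nonneg_left hT (sub_pos.2 hs).le
    -- A zero gap annihilates both sides, whatever the value of the quotient by `kl`.
    · simp [hs]
  have hlog : Filter.Tendsto (fun T : ℕ => Real.log T) Filter.atTop Filter.atTop :=
    Real.tendsto_log_atTop.comp tendsto_natCast_atTop_atTop
  filter_upwards [hall, hlog.eventually_ge_atTop (C / δ), hlog.eventually_gt_atTop 0]
    with T hT hT1 hT2
  rw [EReal.coe_le_coe_iff, le_div_iff₀ hT2]
  have h1 : (1 - δ) * Real.log T * Z ≤ ∑ s, (F.mean (θ sStar) - F.mean (θ s)) *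
      (DetMDP.DMDP.stateDependent next θ : DetMDP.DMDP S A F).expEntries π s₁ s T := by
    refine le_trans (le_of_eq ?_) (Finset.sum_le_sum fun s _ => hT s)
    rw [← Finset.add_sum_erase _ _ (Finset.mem_univ sStar), hZ, Finset.mul_sum]
    simp only [sub_self, zero_mul, zero_add]
    exact Finset.sum_congr rfl fun s _ => by ring
  have h2 : C ≤ δ * Real.log T := by rwa [div_le_iff₀ hδ0, mul_comm] at hT1
  have h3 := hC T
  have h4 := mul_le_mul_of_nonneg_right hδZ hT2.le
  linarith
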